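/- For a two-outcome projective measurement $(P^1,P^\perp)$ on a finite-dimensional Hilbert space ($P^1,P^\perp$ orthogonal projections with $P^1+P^\perp=\mathbb I$) call $P^1$ its $0/1$-outcome observable and $P^1-P^\perp$ its $\pm1$-outcome observable. For operators $A_1,A_2,A_3$ on one space and $B_1,B_4,B_6$ on another, define the two forms of the $I_{3322}$ Bell operator $$\mathbb B^{v}(A,B)=-A_2\otimes\mathbb I-\mathbb I\otimes B_1-2\,\mathbb I\otimes B_4+A_1\otimes B_1+A_1\otimes B_4+A_2\otimes B_1+A_2\otimes B_4-A_1\otimes B_6+A_2\otimes B_6-A_3\otimes B_1+A_3\otimes B_4,$$ $$\mathbb B^{\gamma}(A,B)=A_1\otimes\mathbb I+A_2\otimes\mathbb I+\mathbb I\otimes B_1+\mathbb I\otimes B_4-A_1\otimes B_1-A_1\otimes B_4-A_2\otimes B_1-A_2\otimes B_4-A_1\otimes B_6+A_2\otimes B_6-A_3\otimes B_1+A_3\otimes B_4.$$ 1. Let $A_1,A_2,A_3,B_1,B_4,B_6$ be the $0/1$-outcome observables of any such measurements and $A_i',B_j'$ the corresponding $\pm1$-outcome observables. Then, after relabelling the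 outcomes of the third measurement of the first party and of the measurements $1$ and $4$ of the second party, $$\mathbb B^{\gamma}(A_1',A_2',-A_3',-B_1',-B_4',B_6')=4\,\mathbb B^{v}(A_1,A_2,A_3,B_1,B_4,B_6)+4\,\mathbb I\otimes\mathbb I .$$ 2. Let $\mathcal B_Q^{v}$ (respectively $\mathcal B_Q^{\gamma}$) be the supremum of $\mathrm{Tr}(\mathbb B^{v}\rho)$ (respectively $\mathrm{Tr}(\mathbb B^{\gamma}\rho)$) over all two-qubit states $\rho$ on $\mathbb C^2\otimes\mathbb C^2$ and all $0/1$-outcome (respectively $\pm1$-outcome) observables $A_1,A_2,A_3,B_1,B_4,B_6$ on $\mathbb C^2$. These suprema are finite, $\mathcal B_Q^{\gamma}=4\mathcal B_Q^{v}+4$, and $$0.25\le\mathcal B_Q^{v}\le 0.25085,\qquad 1\le\mathcal B_Q^{\gamma}-4\le 1.0034 .$$ -/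

import Mathlib

open scoped Kronecker ComplexOrder

/-- A two-outcome projective measurement on `ℂⁿ`: a pair of complementary orthogonal
projections `P¹`, `P^⊥` with `P¹ + P^⊥ = 1`. -/
structure BinaryMeasurement (n : Type*) [Fintype n] [DecidableEq n] where
  /-- The projection `P¹` of the outcome `1`. -/
  one : Matrix n n ℂ
  /-- The projection `P^⊥` of the other outcome (labelled `0` or `-1`). -/
  perp : Matrix n n ℂ
  isStarProjection_one : IsStarProjection one
  isStarProjection_perp : IsStarProjection perp
  one_add_perp : one + perp = 1

namespace BinaryMeasurement

variable {n : Type*} [Fintype n] [DecidableEq n]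

/-- The observable with outcomes `1` and `0`. -/
def obs01 (M : BinaryMeasurement n) : Matrix n n ℂ :=
  (1 : ℂ) • M.one + (0 : ℂ) • M.perp

/-- The observable with outcomes `1` and `-1`. -/
def obsPM (M : BinaryMeasurement n) : Matrix n n ℂ :=
  (1 : ℂ) • M.one + (-1 : ℂ) • M.perp

end BinaryMeasurement

/-- The `I₃₃₂₂` Bell operator in the form used with observables of outcomes `0` and `1`. -/
def bellOpV {m n : Type*} [DecidableEq m] [DecidableEq n]
    (A₁ A₂ A₃ : Matrix m m ℂ) (B₁ B₄ B₆ : Matrix n n ℂ) : Matrix (m × n) (m × n) ℂ :=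
  -(A₂ ⊗ₖ (1 : Matrix n n ℂ)) - (1 : Matrix m m ℂ) ⊗ₖ B₁
    - (2 : ℂ) • ((1 : Matrix m m ℂ) ⊗ₖ B₄)
    + A₁ ⊗ₖ B₁ + A₁ ⊗ₖ B₄ + A₂ ⊗ₖ B₁ + A₂ ⊗ₖ B₄ - A₁ ⊗ₖ B₆ + A₂ ⊗ₖ B₆
    - A₃ ⊗ₖ B₁ + A₃ ⊗ₖ B₄

/-- The `I₃₃₂₂` Bell operator in the form used with observables of outcomes `1` and `-1`. -/
def bellOpGamma {m n : Type*} [DecidableEq m] [DecidableEq n]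
    (A₁ A₂ A₃ : Matrix m m ℂ) (B₁ B₄ B₆ : Matrix n n ℂ) : Matrix (m × n) (m × n) ℂ :=
  A₁ ⊗ₖ (1 : Matrix n n ℂ) + A₂ ⊗ₖ (1 : Matrix n n ℂ)
    + (1 : Matrix m m ℂ) ⊗ₖ B₁ + (1 : Matrix m m ℂ) ⊗ₖ B₄
    - A₁ ⊗ₖ B₁ - A₁ ⊗ₖ B₄ - A₂ ⊗ₖ B₁ - A₂ ⊗ₖ B₄ - A₁ ⊗ₖ B₆ + A₂ ⊗ₖ B₆
    - A₃ ⊗ₖ B₁ + A₃ ⊗ₖ B₄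

/-- Density operators (quantum states) on `ℂᵏ`. -/
def IsDensityMatrix {k : Type*} [Fintype k] (ρ : Matrix k k ℂ) : Prop :=
  ρ.PosSemidef ∧ ρ.trace = 1

/-- The values `Tr(𝔹 ρ)` of the 0/1-outcome Bell operator, over all two-qubit states `ρ` and
all 0/1-valued qubit observables. (The trace is real since both factors are Hermitian.) -/
def quantumValuesV : Set ℝ :=
  {x | ∃ (ρ : Matrix (Fin 2 × Fin 2) (Fin 2 × Fin 2) ℂ)
      (A₁ A₂ A₃ B₁ B₄ B₆ : BinaryMeasurement (Fin 2)),
    IsDensityMatrix ρ ∧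
    x = (bellOpV A₁.obs01 A₂.obs01 A₃.obs01 B₁.obs01 B₄.obs01 B₆.obs01 * ρ).trace.re}

/-- The values `Tr(𝔹 ρ)` of the ±1-outcome Bell operator, over all two-qubit states `ρ` and
all ±1-valued qubit observables. -/
def quantumValuesGamma : Set ℝ :=
  {x | ∃ (ρ : Matrix (Fin 2 × Fin 2) (Fin 2 × Fin 2) ℂ)
      (A₁ A₂ A₃ B₁ B₄ B₆ : BinaryMeasurement (Fin 2)),
    IsDensityMatrix ρ ∧
    x = (bellOpGamma A₁.obsPM A₂.obsPM A₃.obsPM B₁.obsPM B₄.obsPM B₆.obsPM * ρ).trace.re}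

/-- The two-qubit Tsirelson bound of the 0/1-outcome Bell operator. -/
noncomputable def tsirelsonV : ℝ := sSup quantumValuesV

/-- The two-qubit Tsirelson bound of the ±1-outcome Bell operator. -/
noncomputable def tsirelsonGamma : ℝ := sSup quantumValuesGamma

/-! Both suprema are attained, with exact values `1/4` and `5`; the stated intervals contain them.
Since `A' = 2A - 1`, the operator identity is an affine substitution, and it reduces everything to
the `±1` form.

Upper bound `5`: a qubit `±1` observable is `1`, `-1` or traceless. If one of `A₁`, `A₂`, `B₁`, `B₄`
is `±1`, a few explicit positive terms suffice (`le_of_left_one`, `le_of_left_neg_one` and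
symmetries). Otherwise `A₁, A₂` and `B₁, B₄` have scalar anticommutators. With `S, D = A₁ ± A₂` and
`T, F = B₁ ± B₄` the expression is `S + T - ST - DB₆ - A₃F`, where `S² = 4p²`, `D² = 4 - 4p²`, `T² =
4q²`, `F² = 4 - 4q²`. As `S` anticommutes with `DB₆` and `T` with `A₃F`, the uncertainty relation
`two_mul_add_le` trades the marginals against these correlations, while positivity controls
`-E(ST)`.

The value `5` is reached by the singlet with coplanar spins. -/

/-- The `I₃₃₂₂` expression for `±1`-valued observables, as an element of a ring. -/
def bellGamma {R : Type*} [Ring R] (A₁ A₂ A₃ B₁ B₄ B₆ : R) : R :=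
  A₁ + A₂ + B₁ + B₄ - A₁ * B₁ - A₁ * B₄ - A₂ * B₁ - A₂ * B₄ - A₁ * B₆ + A₂ * B₆
    - A₃ * B₁ + A₃ * B₄

/-- A family of commuting `±1`-valued observables of two parties. -/
structure IsBipartite {R : Type*} [Ring R] [StarRing R] (A₁ A₂ A₃ B₁ B₄ B₆ : R) : Prop where
  sa₁ : IsSelfAdjoint A₁
  sa₂ : IsSelfAdjoint A₂
  sa₃ : IsSelfAdjoint A₃
  sb₁ : IsSelfAdjoint B₁
  sb₄ : IsSelfAdjoint B₄
  sb₆ : IsSelfAdjoint B₆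
  qa₁ : A₁ * A₁ = 1
  qa₂ : A₂ * A₂ = 1
  qa₃ : A₃ * A₃ = 1
  qb₁ : B₁ * B₁ = 1
  qb₄ : B₄ * B₄ = 1
  qb₆ : B₆ * B₆ = 1
  c₁₁ : Commute A₁ B₁
  c₁₄ : Commute A₁ B₄
  c₁₆ : Commute A₁ B₆
  c₂₁ : Commute A₂ B₁
  c₂₄ : Commute A₂ B₄
  c₂₆ : Commute A₂ B₆
  c₃₁ : Commute A₃ B₁
  c₃₄ : Commute A₃ B₄

/-! ### Symmetries of the Bell expression -/

theorem bellGamma_swap_settings {R : Type*} [Ring R] {A₁ A₂ A₃ B₁ B₄ B₆ : R} :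
    bellGamma A₂ A₁ A₃ B₁ B₄ (-B₆) = bellGamma A₁ A₂ A₃ B₁ B₄ B₆ := by
  unfold bellGamma
  simp only [mul_neg]
  abel

section Swap

variable {R : Type*} [Ring R] [StarRing R] {A₁ A₂ A₃ B₁ B₄ B₆ : R}

theorem IsBipartite.swap_parties (h : IsBipartite A₁ A₂ A₃ B₁ B₄ B₆) :
    IsBipartite B₁ B₄ B₆ A₁ A₂ A₃ := by
  obtain ⟨h1, h2, h3, h4, h5, h6, h7, h8, h9, h10, h11, h12, k1, k2, k3, k4, k5, k6, k7, k8⟩ := h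
  exact ⟨h4, h5, h6, h1, h2, h3, h10, h11, h12, h7, h8, h9, k1.symm, k4.symm, k7.symm,
    k2.symm, k5.symm, k8.symm, k3.symm, k6.symm⟩

theorem IsBipartite.bellGamma_swap_parties (h : IsBipartite A₁ A₂ A₃ B₁ B₄ B₆) :
    bellGamma B₁ B₄ B₆ A₁ A₂ A₃ = bellGamma A₁ A₂ A₃ B₁ B₄ B₆ := by
  unfold bellGamma
  rw [h.c₁₁.eq, h.c₁₄.eq, h.c₁₆.eq, h.c₂₁.eq, h.c₂₄.eq, h.c₂₆.eq, h.c₃₁.eq, h.c₃₄.eq]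
  abel

theorem IsBipartite.swap_settings (h : IsBipartite A₁ A₂ A₃ B₁ B₄ B₆) :
    IsBipartite A₂ A₁ A₃ B₁ B₄ (-B₆) := by
  obtain ⟨h1, h2, h3, h4, h5, h6, h7, h8, h9, h10, h11, h12, k1, k2, k3, k4, k5, k6, k7, k8⟩ := h
  exact ⟨h2, h1, h3, h4, h5, h6.neg, h8, h7, h9, h10, h11, by simpa using h12, k4, k5,
    k6.neg_right, k1, k2, k3.neg_right, k7, k8⟩

end Swap

/-! ### The upper bound for abstract states -/

/-- A state on a real star algebra: a normalized linear functional that is nonnegative on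
squares of self-adjoint elements. -/
structure IsStateFunctional {R : Type*} [Ring R] [StarRing R] [Algebra ℝ R]
    (E : R →ₗ[ℝ] ℝ) : Prop where
  map_one : E 1 = 1
  nonneg : ∀ Y, IsSelfAdjoint Y → 0 ≤ E (Y * Y)

namespace IsStateFunctional

variable {R : Type*} [Ring R] [StarRing R] [Algebra ℝ R]
  {E : R →ₗ[ℝ] ℝ} {A₁ A₂ A₃ B₁ B₄ B₆ : R}

/-- `X` and `Y` are positive multiples of commuting projections, so `(XY)²` is a positive multiple
of `XY`. -/
theorem mul_nonneg_of_commute (hE : IsStateFunctional E) {X Y : R} (hX : IsSelfAdjoint X)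
    (hY : IsSelfAdjoint Y) (hXY : Commute X Y) {k l : ℝ} (hk : 0 < k) (hl : 0 < l)
    (hXX : X * X = k • X) (hYY : Y * Y = l • Y) : 0 ≤ E (X * Y) := by
  have h := hE.nonneg (X * Y) ((hX.commute_iff hY).mp hXY)
  rw [hXY.symm.mul_mul_mul_comm, hXX, hYY, smul_mul_smul_comm, map_smul, smul_eq_mul] at h
  exact nonneg_of_mul_nonneg_right h (mul_pos hk hl)

variable [StarModule ℝ R]

theorem quadratic_nonneg (hE : IsStateFunctional E) {X Y : R} (hX : IsSelfAdjoint X)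
    (hY : IsSelfAdjoint Y) (hXY : Commute X Y) (x y : ℝ) :
    0 ≤ x ^ 2 * E (X * X) + 2 * x * y * E (X * Y) + y ^ 2 * E (Y * Y) := by
  have h := hE.nonneg (x • X + y • Y)
    (((IsSelfAdjoint.all x).smul hX).add ((IsSelfAdjoint.all y).smul hY))
  simp only [mul_add, add_mul, smul_mul_assoc, mul_smul_comm, map_add, map_smul, smul_eq_mul,
    ← hXY.eq] at h
  linarith

/-- Two anticommuting observables with scalar squares satisfy an uncertainty relation. -/
theorem two_mul_add_le (hE : IsStateFunctional E) {X Y : R} (hX : IsSelfAdjoint X)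
    (hY : IsSelfAdjoint Y) (hXY : X * Y + Y * X = 0) {x y : ℝ}
    (hXX : X * X = x • (1 : R)) (hYY : Y * Y = y • (1 : R)) (u k : ℝ) :
    2 * k * (u * E X + E Y) ≤ k ^ 2 + u ^ 2 * x + y := by
  have h := hE.nonneg (k • (1 : R) - u • X - Y)
    ((((IsSelfAdjoint.all k).smul (IsSelfAdjoint.one R)).sub
      ((IsSelfAdjoint.all u).smul hX)).sub hY)
  have e : (k • (1 : R) - u • X - Y) * (k • (1 : R) - u • X - Y) =
      k ^ 2 • (1 : R) + u ^ 2 • (X * X) + Y * Y - (2 * k * u) • X - (2 * k) • Y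
        + u • (X * Y + Y * X) := by
    simp only [mul_sub, sub_mul, smul_mul_assoc, mul_smul_comm, one_mul, mul_one]
    module
  rw [e, hXY, hXX, hYY] at h
  simp only [map_add, map_sub, map_smul, smul_eq_mul, hE.map_one, smul_zero, map_zero] at h
  linarith

/-- The value of `I₃₃₂₂` when the two first measurements of each party generate qubit
algebras with traceless observables. -/
theorem bellGamma_le_of_anticommutator (hE : IsStateFunctional E)
    (h : IsBipartite A₁ A₂ A₃ B₁ B₄ B₆) {c d : ℝ}
    (hc : A₁ * A₂ + A₂ * A₁ = (2 * c) • (1 : R)) (hd : B₁ * B₄ + B₄ * B₁ = (2 * d) • (1 : R)) :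
    E (bellGamma A₁ A₂ A₃ B₁ B₄ B₆) ≤ 5 := by
  have hSS : (A₁ + A₂) * (A₁ + A₂) = (2 + 2 * c) • (1 : R) := by
    have : (A₁ + A₂) * (A₁ + A₂) = A₁ * A₁ + A₂ * A₂ + (A₁ * A₂ + A₂ * A₁) := by noncomm_ring
    rw [this, h.qa₁, h.qa₂, hc]; module
  have hDD : (A₁ - A₂) * (A₁ - A₂) = (2 - 2 * c) • (1 : R) := by
    have : (A₁ - A₂) * (A₁ - A₂) = A₁ * A₁ + A₂ * A₂ - (A₁ * A₂ + A₂ * A₁) := by noncomm_ring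
    rw [this, h.qa₁, h.qa₂, hc]; module
  have hSD : (A₁ + A₂) * (A₁ - A₂) + (A₁ - A₂) * (A₁ + A₂) = 0 := by
    have : (A₁ + A₂) * (A₁ - A₂) + (A₁ - A₂) * (A₁ + A₂) =
      2 * (A₁ * A₁) - 2 * (A₂ * A₂) := by noncomm_ring
    rw [this, h.qa₁, h.qa₂]; simp
  have hTT : (B₁ + B₄) * (B₁ + B₄) = (2 + 2 * d) • (1 : R) := by
    have : (B₁ + B₄) * (B₁ + B₄) = B₁ * B₁ + B₄ * B₄ + (B₁ * B₄ + B₄ * B₁) := by noncomm_ring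
    rw [this, h.qb₁, h.qb₄, hd]; module
  have hFF : (B₁ - B₄) * (B₁ - B₄) = (2 - 2 * d) • (1 : R) := by
    have : (B₁ - B₄) * (B₁ - B₄) = B₁ * B₁ + B₄ * B₄ - (B₁ * B₄ + B₄ * B₁) := by noncomm_ring
    rw [this, h.qb₁, h.qb₄, hd]; module
  have hTF : (B₁ + B₄) * (B₁ - B₄) + (B₁ - B₄) * (B₁ + B₄) = 0 := by
    have : (B₁ + B₄) * (B₁ - B₄) + (B₁ - B₄) * (B₁ + B₄) =
      2 * (B₁ * B₁) - 2 * (B₄ * B₄) := by noncomm_ring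
    rw [this, h.qb₁, h.qb₄]; simp
  have sS := h.sa₁.add h.sa₂
  have sD := h.sa₁.sub h.sa₂
  have sT := h.sb₁.add h.sb₄
  have sF := h.sb₁.sub h.sb₄
  have cST : Commute (A₁ + A₂) (B₁ + B₄) :=
    (h.c₁₁.add_right h.c₁₄).add_left (h.c₂₁.add_right h.c₂₄)
  have cS6 : Commute (A₁ + A₂) B₆ := h.c₁₆.add_left h.c₂₆
  have cD6 : Commute (A₁ - A₂) B₆ := h.c₁₆.sub_left h.c₂₆
  have c3T : Commute A₃ (B₁ + B₄) := h.c₃₁.add_right h.c₃₄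
  have c3F : Commute A₃ (B₁ - B₄) := h.c₃₁.sub_right h.c₃₄
  have hG : bellGamma A₁ A₂ A₃ B₁ B₄ B₆ = (A₁ + A₂) + (B₁ + B₄) - (A₁ + A₂) * (B₁ + B₄)
      - (A₁ - A₂) * B₆ - A₃ * (B₁ - B₄) := by
    unfold bellGamma; noncomm_ring
  rw [hG]
  have pS := hE.nonneg _ sS
  have pD := hE.nonneg _ sD
  have pT := hE.nonneg _ sT
  have pF := hE.nonneg _ sF
  rw [hSS, map_smul, hE.map_one, smul_eq_mul, mul_one] at pS
  rw [hDD, map_smul, hE.map_one, smul_eq_mul, mul_one] at pD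
  rw [hTT, map_smul, hE.map_one, smul_eq_mul, mul_one] at pT
  rw [hFF, map_smul, hE.map_one, smul_eq_mul, mul_one] at pF
  generalize A₁ + A₂ = S at *
  generalize A₁ - A₂ = D at *
  generalize B₁ + B₄ = T at *
  generalize B₁ - B₄ = F at *
  -- Half-angle substitution: if `c = cos θ`, then `p = cos (θ / 2)`.
  obtain ⟨p, hp, rfl⟩ : ∃ p : ℝ, 0 ≤ p ∧ c = 2 * p ^ 2 - 1 := by
    refine ⟨√((1 + c) / 2), Real.sqrt_nonneg _, ?_⟩
    rw [Real.sq_sqrt (by linarith)]; ring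
  obtain ⟨q, hq, rfl⟩ : ∃ q : ℝ, 0 ≤ q ∧ d = 2 * q ^ 2 - 1 := by
    refine ⟨√((1 + d) / 2), Real.sqrt_nonneg _, ?_⟩
    rw [Real.sq_sqrt (by linarith)]; ring
  have uA : ∀ u k : ℝ, 2 * k * (u * E S - E (D * B₆)) ≤
      k ^ 2 + u ^ 2 * (4 * p ^ 2) + (4 - 4 * p ^ 2) := by
    intro u k
    have := hE.two_mul_add_le sS ((sD.commute_iff h.sb₆).mp cD6).neg (x := 4 * p ^ 2)
      (y := 4 - 4 * p ^ 2) ?_ ?_ ?_ u k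
    · simpa [sub_eq_add_neg] using this
    · have e : S * -(D * B₆) + -(D * B₆) * S = -((S * D + D * S) * B₆) := by
        rw [neg_mul, mul_assoc D, ← cS6.eq]; noncomm_ring
      rw [e, hSD]; simp
    · rw [hSS]; congr 1; ring
    · rw [neg_mul_neg, cD6.symm.mul_mul_mul_comm, hDD, h.qb₆, mul_one]; congr 1; ring
  have uB : ∀ u k : ℝ, 2 * k * (u * E T - E (A₃ * F)) ≤
      k ^ 2 + u ^ 2 * (4 * q ^ 2) + (4 - 4 * q ^ 2) := by
    intro u k
    have := hE.two_mul_add_le sT ((h.sa₃.commute_iff sF).mp c3F).neg (x := 4 * q ^ 2)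
      (y := 4 - 4 * q ^ 2) ?_ ?_ ?_ u k
    · simpa [sub_eq_add_neg] using this
    · have e : T * -(A₃ * F) + -(A₃ * F) * T = -(A₃ * (T * F + F * T)) := by
        rw [mul_neg, ← mul_assoc T, ← c3T.eq]; noncomm_ring
      rw [e, hTF]; simp
    · rw [hTT]; congr 1; ring
    · rw [neg_mul_neg, c3F.symm.mul_mul_mul_comm, hFF, h.qa₃, one_mul]; congr 1; ring
  have qST : ∀ x y : ℝ,
      0 ≤ x ^ 2 * (4 * p ^ 2) + 2 * x * y * E (S * T) + y ^ 2 * (4 * q ^ 2) := by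
    intro x y
    have := hE.quadratic_nonneg sS sT cST x y
    rw [hSS, hTT] at this
    simp only [map_smul, hE.map_one, smul_eq_mul] at this
    linarith
  simp only [map_sub, map_add]
  -- These choices cancel `p` and `q`: `E S - E(DB₆)` and `E T - E(A₃F)` are at most `2` each. Hence
  -- `-E(ST) ≤ 1` is enough until `p + q ≥ 1`.
  have a1 := uA 1 2
  have b1 := uB 1 2
  rcases hp.eq_or_lt with hp0 | hp0
  · subst hp0
    have := qST 2 (1 / 2)
    nlinarith
  rcases hq.eq_or_lt with hq0 | hq0
  · subst hq0
    have := qST (1 / 2) 2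
    nlinarith
  rcases le_total (p + q) 1 with hpq | hpq
  · have h1 := qST q p
    have h2 : 0 ≤ 2 * p * q * (E (S * T) + 4 * (p * q)) := by linarith
    have h3 := nonneg_of_mul_nonneg_right h2 (by positivity)
    nlinarith [sq_nonneg (p - q)]
  · have pos : ∀ ε : ℝ, ε ^ 2 = 1 →
        0 ≤ 4 * p * q + ε * (2 * q * E S + 2 * p * E T) + E (S * T) := by
      intro ε hε
      have hX : IsSelfAdjoint ((2 * p) • (1 : R) + ε • S) :=
        ((IsSelfAdjoint.all _).smul (IsSelfAdjoint.one R)).add ((IsSelfAdjoint.all _).smul sS)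
      have hY : IsSelfAdjoint ((2 * q) • (1 : R) + ε • T) :=
        ((IsSelfAdjoint.all _).smul (IsSelfAdjoint.one R)).add ((IsSelfAdjoint.all _).smul sT)
      have sq : ∀ (Z : R) (r : ℝ), Z * Z = (4 * r ^ 2) • (1 : R) →
          ((2 * r) • (1 : R) + ε • Z) * ((2 * r) • (1 : R) + ε • Z) =
            (4 * r) • ((2 * r) • (1 : R) + ε • Z) := by
        intro Z r hZ
        simp only [mul_add, add_mul, smul_mul_assoc, mul_smul_comm, one_mul, mul_one, hZ,
          smul_add, smul_smul]
        rw [show ε * (ε * (4 * r ^ 2)) = 4 * r ^ 2 by linear_combination (4 * r ^ 2) * hε]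
        module
      have := hE.mul_nonneg_of_commute hX hY
        ((((Commute.one_left _).smul_left _)).add_left
          ((((Commute.one_right S).smul_right _).add_right (cST.smul_right _)).smul_left _))
        (k := 4 * p) (l := 4 * q) (by positivity) (by positivity)
        (sq S p (by rw [hSS]; congr 1; ring)) (sq T q (by rw [hTT]; congr 1; ring))
      simp only [mul_add, add_mul, smul_mul_assoc, mul_smul_comm, one_mul, mul_one,
        map_add, map_smul, smul_eq_mul, hE.map_one] at this
      linear_combination this + E (S * T) * hε
    have h1 := pos 1 (by norm_num)
    have h2 := pos (-1) (by norm_num)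
    have hs : 0 < p + q := by linarith
    -- The weight `l = 1 / (p + q)` makes the remaining coefficients of `E S` and `E T` opposite. It
    -- is at most `1` because `p + q ≥ 1`, so `h3` is the convex combination of `h1` and `h2` with
    -- weights `(1 ∓ l) / 2`.
    obtain ⟨l, hl⟩ : ∃ l : ℝ, l * (p + q) = 1 := ⟨(p + q)⁻¹, inv_mul_cancel₀ hs.ne'⟩
    have hl0 : 0 ≤ l := by
      by_contra! hlt
      nlinarith
    have hl1 : l ≤ 1 := by nlinarith
    have h3 : 0 ≤ 4 * p * q - l * (2 * q * E S + 2 * p * E T) + E (S * T) := by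
      nlinarith [mul_nonneg hl0 h2, mul_nonneg (sub_nonneg.2 hl1) h1,
        mul_nonneg (sub_nonneg.2 hl1) h2]
    have a2 := uA (1 - 2 * q * l) 1
    have b2 := uB (1 - 2 * p * l) 1
    have e1 : 1 - 2 * q * l = l * (p - q) := by linear_combination -hl
    have e2 : 1 - 2 * p * l = -(l * (p - q)) := by linear_combination -hl
    -- Adding `h3` to half of `a2` and `b2` bounds the value by `5` plus twice the difference of the
    -- two sides of `key`.
    have key : (1 - 2 * q * l) ^ 2 * p ^ 2 + (1 - 2 * p * l) ^ 2 * q ^ 2 + 2 * (p * q)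
        ≤ p ^ 2 + q ^ 2 := by
      rw [e1, e2]
      have e3 : p ^ 2 + q ^ 2 - ((l * (p - q)) ^ 2 * p ^ 2 + (-(l * (p - q))) ^ 2 * q ^ 2
          + 2 * (p * q)) = (l * (p - q)) ^ 2 * (2 * (p * q)) := by
        linear_combination (-(p - q) ^ 2 * (l * (p + q) + 1)) * hl
      have : 0 ≤ (l * (p - q)) ^ 2 * (2 * (p * q)) := by positivity
      linarith
    linarith

/-- The terms in `B₁` and `B₄` cost at most `2` plus a quarter of `(A₂ + A₃)² + (A₂ - A₃)² = 4`;
positivity of `(1 - A₂)(1 + B₆)` handles the rest. -/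
theorem le_of_left_one (hE : IsStateFunctional E) (h : IsBipartite 1 A₂ A₃ B₁ B₄ B₆) :
    E (bellGamma 1 A₂ A₃ B₁ B₄ B₆) ≤ 5 := by
  have sq : ∀ Z : R, Z * Z = 1 → (1 + Z) * (1 + Z) = (2 : ℝ) • (1 + Z) := by
    intro Z hZ
    simp only [mul_add, add_mul, one_mul, mul_one, hZ]
    module
  have h1 := hE.mul_nonneg_of_commute (X := 1 + -A₂) (Y := 1 + B₆)
    ((IsSelfAdjoint.one R).add h.sa₂.neg) ((IsSelfAdjoint.one R).add h.sb₆)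
    ((Commute.one_left _).add_left ((Commute.one_right _).add_right h.c₂₆.neg_left))
    two_pos two_pos (sq _ (by simpa using h.qa₂)) (sq _ h.qb₆)
  have h2 := hE.quadratic_nonneg (h.sa₂.add h.sa₃) h.sb₁ (h.c₂₁.add_left h.c₃₁) 1 2
  have h3 := hE.quadratic_nonneg (h.sa₂.sub h.sa₃) h.sb₄ (h.c₂₄.sub_left h.c₃₄) 1 2
  unfold bellGamma
  simp only [mul_add, add_mul, mul_sub, sub_mul, neg_mul, one_mul, mul_one, map_add, map_sub,
    map_neg, h.qa₂, h.qa₃, h.qb₁, h.qb₄, hE.map_one] at h1 h2 h3 ⊢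
  linarith

/-- Completing squares in `B₁` and `B₄` leaves `(2 - A₂ - A₃)² + (2 - A₂ + A₃)² = 12 - 8A₂`, whose
`A₂` term cancels against positivity of `(1 + A₂)(1 - B₆)`. -/
theorem le_of_left_neg_one (hE : IsStateFunctional E) (h : IsBipartite (-1) A₂ A₃ B₁ B₄ B₆) :
    E (bellGamma (-1) A₂ A₃ B₁ B₄ B₆) ≤ 5 := by
  have sq : ∀ Z : R, Z * Z = 1 → (1 + Z) * (1 + Z) = (2 : ℝ) • (1 + Z) := by
    intro Z hZ
    simp only [mul_add, add_mul, one_mul, mul_one, hZ]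
    module
  have h1 := hE.mul_nonneg_of_commute (X := 1 + A₂) (Y := 1 + -B₆)
    ((IsSelfAdjoint.one R).add h.sa₂) ((IsSelfAdjoint.one R).add h.sb₆.neg)
    ((Commute.one_left _).add_left ((Commute.one_right _).add_right h.c₂₆.neg_right))
    two_pos two_pos (sq _ h.qa₂) (sq _ (by simpa using h.qb₆))
  have s2 : IsSelfAdjoint (1 + 1 - A₂) :=
    ((IsSelfAdjoint.one R).add (IsSelfAdjoint.one R)).sub h.sa₂
  have c2 : ∀ Z : R, Commute A₂ Z → Commute (1 + 1 - A₂) Z := fun Z hZ =>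
    ((Commute.one_left Z).add_left (Commute.one_left Z)).sub_left hZ
  have h2 := hE.quadratic_nonneg (s2.sub h.sa₃) h.sb₁ ((c2 _ h.c₂₁).sub_left h.c₃₁) 1 (-2)
  have h3 := hE.quadratic_nonneg (s2.add h.sa₃) h.sb₄ ((c2 _ h.c₂₄).add_left h.c₃₄) 1 (-2)
  unfold bellGamma
  simp only [mul_add, add_mul, mul_sub, sub_mul, neg_mul, mul_neg, one_mul, mul_one, map_add,
    map_sub, map_neg, h.qa₂, h.qa₃, h.qb₁, h.qb₄, hE.map_one] at h1 h2 h3 ⊢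
  linarith

/-- The bound on `I₃₃₂₂` under the alternatives that qubit observables satisfy. -/
theorem bellGamma_le (hE : IsStateFunctional E) (h : IsBipartite A₁ A₂ A₃ B₁ B₄ B₆)
    (hA : A₁ = 1 ∨ A₁ = -1 ∨ A₂ = 1 ∨ A₂ = -1 ∨
      ∃ c : ℝ, A₁ * A₂ + A₂ * A₁ = (2 * c) • (1 : R))
    (hB : B₁ = 1 ∨ B₁ = -1 ∨ B₄ = 1 ∨ B₄ = -1 ∨
      ∃ d : ℝ, B₁ * B₄ + B₄ * B₁ = (2 * d) • (1 : R)) :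
    E (bellGamma A₁ A₂ A₃ B₁ B₄ B₆) ≤ 5 := by
  have left : ∀ {A₁ A₂ A₃ B₁ B₄ B₆ : R}, IsBipartite A₁ A₂ A₃ B₁ B₄ B₆ →
      (A₁ = 1 ∨ A₁ = -1 ∨ A₂ = 1 ∨ A₂ = -1) → E (bellGamma A₁ A₂ A₃ B₁ B₄ B₆) ≤ 5 := by
    rintro A₁ A₂ A₃ B₁ B₄ B₆ h (rfl | rfl | rfl | rfl)
    · exact hE.le_of_left_one h
    · exact hE.le_of_left_neg_one h
    · rw [← bellGamma_swap_settings]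
      exact hE.le_of_left_one h.swap_settings
    · rw [← bellGamma_swap_settings]
      exact hE.le_of_left_neg_one h.swap_settings
  by_cases hA' : A₁ = 1 ∨ A₁ = -1 ∨ A₂ = 1 ∨ A₂ = -1
  · exact left h hA'
  by_cases hB' : B₁ = 1 ∨ B₁ = -1 ∨ B₄ = 1 ∨ B₄ = -1
  · rw [← h.bellGamma_swap_parties]
    exact left h.swap_parties hB'
  obtain ⟨c, hc⟩ : ∃ c : ℝ, A₁ * A₂ + A₂ * A₁ = (2 * c) • (1 : R) := by tauto
  obtain ⟨d, hd⟩ : ∃ d : ℝ, B₁ * B₄ + B₄ * B₁ = (2 * d) • (1 : R) := by tauto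
  exact hE.bellGamma_le_of_anticommutator h hc hd

end IsStateFunctional

/-! ### Observables of binary measurements and the qubit alternatives -/

namespace BinaryMeasurement

section General

variable {n : Type*} [Fintype n] [DecidableEq n] (M : BinaryMeasurement n)

theorem obs01_eq : M.obs01 = M.one := by simp [obs01]

theorem perp_eq : M.perp = 1 - M.one := eq_sub_of_add_eq' M.one_add_perp

theorem obsPM_eq : M.obsPM = (2 : ℂ) • M.one - 1 := by
  rw [obsPM, perp_eq]; module

theorem isSelfAdjoint_obsPM : IsSelfAdjoint M.obsPM := by
  rw [obsPM_eq, two_smul]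
  exact (M.isStarProjection_one.isSelfAdjoint.add M.isStarProjection_one.isSelfAdjoint).sub
    (IsSelfAdjoint.one _)

theorem obsPM_mul_self : M.obsPM * M.obsPM = 1 := by
  have h : M.one * M.one = M.one := M.isStarProjection_one.isIdempotentElem
  rw [obsPM_eq]
  simp only [mul_sub, sub_mul, smul_mul_assoc, mul_smul_comm, mul_one, one_mul, h]
  module

/-- The measurement with interchanged outcomes. -/
def flip : BinaryMeasurement n where
  one := M.perp
  perp := M.one
  isStarProjection_one := M.isStarProjection_perp
  isStarProjection_perp := M.isStarProjection_one
  one_add_perp := by rw [add_comm]; exact M.one_add_perp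

theorem obsPM_flip : M.flip.obsPM = -M.obsPM := by
  simp [obsPM, flip]

theorem flip_flip : M.flip.flip = M := rfl

/-- The measurement whose `±1`-outcome observable is a given self-adjoint involution. -/
noncomputable def ofInvolution (A : Matrix n n ℂ) (hA : IsSelfAdjoint A) (hAA : A * A = 1) :
    BinaryMeasurement n where
  one := (2⁻¹ : ℝ) • (1 + A)
  perp := (2⁻¹ : ℝ) • (1 - A)
  isStarProjection_one :=
    { isIdempotentElem := by
        simp only [IsIdempotentElem, smul_mul_smul_comm, mul_add, add_mul, one_mul, mul_one, hAA]
        module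
      isSelfAdjoint := (IsSelfAdjoint.all _).smul ((IsSelfAdjoint.one _).add hA) }
  isStarProjection_perp :=
    { isIdempotentElem := by
        simp only [IsIdempotentElem, smul_mul_smul_comm, mul_sub, sub_mul, one_mul, mul_one, hAA]
        module
      isSelfAdjoint := (IsSelfAdjoint.all _).smul ((IsSelfAdjoint.one _).sub hA) }
  one_add_perp := by module

theorem obsPM_ofInvolution (A : Matrix n n ℂ) (hA : IsSelfAdjoint A) (hAA : A * A = 1) :
    (ofInvolution A hA hAA).obsPM = A := by
  simp only [obsPM, ofInvolution]
  module

end General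

variable (M N : BinaryMeasurement (Fin 2))

/-- In `A² = 1` the off-diagonal entries and the difference of the diagonal ones are each killed by
the trace, so a nonzero trace forces a scalar matrix. -/
theorem obsPM_fin_two :
    M.obsPM = 1 ∨ M.obsPM = -1 ∨ M.obsPM 1 1 = -M.obsPM 0 0 := by
  have h := M.obsPM_mul_self
  generalize M.obsPM = A at h ⊢
  have h00 := congrFun (congrFun h 0) 0
  have h01 := congrFun (congrFun h 0) 1
  have h10 := congrFun (congrFun h 1) 0
  have h11 := congrFun (congrFun h 1) 1
  simp [Matrix.mul_apply, Fin.sum_univ_two] at h00 h01 h10 h11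
  by_cases ht : A 0 0 + A 1 1 = 0
  · exact Or.inr (Or.inr (by linear_combination ht))
  have b : A 0 1 = 0 := (mul_eq_zero.mp
    (show A 0 1 * (A 0 0 + A 1 1) = 0 by linear_combination h01)).resolve_right ht
  have c : A 1 0 = 0 := (mul_eq_zero.mp
    (show A 1 0 * (A 0 0 + A 1 1) = 0 by linear_combination h10)).resolve_right ht
  have e : A 0 0 - A 1 1 = 0 := (mul_eq_zero.mp
    (show (A 0 0 - A 1 1) * (A 0 0 + A 1 1) = 0 by linear_combination h00 - h11)).resolve_right ht
  rw [b, zero_mul, add_zero] at h00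
  rcases mul_self_eq_one_iff.mp h00 with a | a
  · left
    ext i j
    fin_cases i <;> fin_cases j <;> simp [a, b, c]
    linear_combination a - e
  · right; left
    ext i j
    fin_cases i <;> fin_cases j <;> simp [a, b, c]
    linear_combination a - e

/-- Traceless `2 × 2` matrices have scalar anticommutator (polarized Cayley–Hamilton);
self-adjointness makes the scalar real. -/
theorem obsPM_alternatives :
    M.obsPM = 1 ∨ M.obsPM = -1 ∨ N.obsPM = 1 ∨ N.obsPM = -1 ∨
      ∃ c : ℝ, M.obsPM * N.obsPM + N.obsPM * M.obsPM =
        (2 * c) • (1 : Matrix (Fin 2) (Fin 2) ℂ) := by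
  rcases M.obsPM_fin_two with h | h | hM
  · exact Or.inl h
  · exact Or.inr (Or.inl h)
  rcases N.obsPM_fin_two with h | h | hN
  · exact Or.inr (Or.inr (Or.inl h))
  · exact Or.inr (Or.inr (Or.inr (Or.inl h)))
  refine Or.inr (Or.inr (Or.inr (Or.inr ?_)))
  have sM := M.isSelfAdjoint_obsPM
  have sN := N.isSelfAdjoint_obsPM
  generalize M.obsPM = A at *
  generalize N.obsPM = B at *
  have sa : ∀ i j, star (A j i) = A i j := fun i j => congrFun (congrFun sM i) j
  have sb : ∀ i j, star (B j i) = B i j := fun i j => congrFun (congrFun sN i) j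
  have key : A * B + B * A = (2 * A 0 0 * B 0 0 + A 0 1 * B 1 0 + B 0 1 * A 1 0) •
      (1 : Matrix (Fin 2) (Fin 2) ℂ) := by
    ext i j
    fin_cases i <;> fin_cases j <;>
      simp [Matrix.mul_apply, Fin.sum_univ_two, hM, hN] <;> ring
  obtain ⟨r, hr⟩ : ∃ r : ℝ, (r : ℂ) = 2 * A 0 0 * B 0 0 + A 0 1 * B 1 0 + B 0 1 * A 1 0 := by
    refine Complex.conj_eq_iff_real.mp ?_ |>.imp fun _ h => h.symm
    have a0 := sa 0 0
    have b0 := sb 0 0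
    have a1 := sa 0 1
    have b1 := sb 0 1
    have a2 := sa 1 0
    have b2 := sb 1 0
    simp only [Complex.star_def] at a0 b0 a1 b1 a2 b2
    simp only [map_add, map_mul, a0, b0, a1, b1, a2, b2, map_ofNat]
    ring
  refine ⟨r / 2, ?_⟩
  rw [key, ← hr]
  ext i j
  simp [Matrix.smul_apply]
  left; ring

end BinaryMeasurement

/-! ### The operator identity and the bound for two-qubit states -/

theorem bellOpGamma_obsPM {m n : Type*} [Fintype m] [DecidableEq m] [Fintype n] [DecidableEq n]
    (A₁ A₂ A₃ : BinaryMeasurement m) (B₁ B₄ B₆ : BinaryMeasurement n) :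
    bellOpGamma A₁.obsPM A₂.obsPM (-A₃.obsPM) (-B₁.obsPM) (-B₄.obsPM) B₆.obsPM =
      (4 : ℂ) • bellOpV A₁.obs01 A₂.obs01 A₃.obs01 B₁.obs01 B₄.obs01 B₆.obs01
        + (4 : ℂ) • ((1 : Matrix m m ℂ) ⊗ₖ (1 : Matrix n n ℂ)) := by
  simp only [BinaryMeasurement.obs01_eq, BinaryMeasurement.obsPM_eq]
  ext ⟨i, k⟩ ⟨j, l⟩
  simp only [bellOpGamma, bellOpV, Matrix.add_apply, Matrix.sub_apply, Matrix.neg_apply,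
    Matrix.smul_apply, Matrix.kroneckerMap_apply, smul_eq_mul]
  ring

section State

variable {k : Type*} [Fintype k]

/-- The expectation value `M ↦ Re Tr(M ρ)`. -/
noncomputable def expectation (ρ : Matrix k k ℂ) : Matrix k k ℂ →ₗ[ℝ] ℝ where
  toFun M := (M * ρ).trace.re
  map_add' M N := by simp [add_mul]
  map_smul' r M := by simp

theorem isStateFunctional_expectation [DecidableEq k] {ρ : Matrix k k ℂ}
    (hρ : IsDensityMatrix ρ) : IsStateFunctional (expectation ρ) where
  map_one := by simp [expectation, hρ.2]
  nonneg Y hY := by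
    have h := (hρ.1.mul_mul_conjTranspose_same Y).trace_nonneg
    have e : (Y * Y * ρ).trace = (Y * ρ * Y.conjTranspose).trace := by
      rw [← Matrix.star_eq_conjTranspose, hY.star_eq, Matrix.trace_mul_comm (Y * ρ), mul_assoc]
    rw [← e] at h
    exact (Complex.nonneg_iff.mp h).1

end State

theorem neg_kronecker_one {m n : Type*} [DecidableEq n] (A : Matrix m m ℂ) :
    (-A) ⊗ₖ (1 : Matrix n n ℂ) = -(A ⊗ₖ (1 : Matrix n n ℂ)) := by
  ext
  simp [Matrix.kroneckerMap_apply]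

theorem one_kronecker_neg {m n : Type*} [DecidableEq m] (B : Matrix n n ℂ) :
    (1 : Matrix m m ℂ) ⊗ₖ (-B) = -((1 : Matrix m m ℂ) ⊗ₖ B) := by
  ext
  simp [Matrix.kroneckerMap_apply]

theorem isSelfAdjoint_kronecker {m n : Type*} {A : Matrix m m ℂ} {B : Matrix n n ℂ} (hA : IsSelfAdjoint A)
    (hB : IsSelfAdjoint B) : IsSelfAdjoint (A ⊗ₖ B) := by
  rw [IsSelfAdjoint, Matrix.star_eq_conjTranspose, Matrix.conjTranspose_kronecker,
    ← Matrix.star_eq_conjTranspose, ← Matrix.star_eq_conjTranspose, hA.star_eq, hB.star_eq]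

section Bipartite

variable {m n : Type*} [Fintype m] [DecidableEq m] [Fintype n] [DecidableEq n]

theorem bellOpGamma_eq_bellGamma (A₁ A₂ A₃ : Matrix m m ℂ) (B₁ B₄ B₆ : Matrix n n ℂ) :
    bellOpGamma A₁ A₂ A₃ B₁ B₄ B₆ =
      bellGamma (A₁ ⊗ₖ 1) (A₂ ⊗ₖ 1) (A₃ ⊗ₖ 1) (1 ⊗ₖ B₁) (1 ⊗ₖ B₄) (1 ⊗ₖ B₆) := by
  simp only [bellOpGamma, bellGamma, ← Matrix.mul_kronecker_mul, one_mul, mul_one]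

theorem isBipartite_kronecker (A₁ A₂ A₃ : BinaryMeasurement m) (B₁ B₄ B₆ : BinaryMeasurement n) :
    IsBipartite (A₁.obsPM ⊗ₖ (1 : Matrix n n ℂ)) (A₂.obsPM ⊗ₖ (1 : Matrix n n ℂ))
      (A₃.obsPM ⊗ₖ (1 : Matrix n n ℂ)) ((1 : Matrix m m ℂ) ⊗ₖ B₁.obsPM)
      ((1 : Matrix m m ℂ) ⊗ₖ B₄.obsPM) ((1 : Matrix m m ℂ) ⊗ₖ B₆.obsPM) := by
  have sA (M : BinaryMeasurement m) : IsSelfAdjoint (M.obsPM ⊗ₖ (1 : Matrix n n ℂ)) :=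
    isSelfAdjoint_kronecker M.isSelfAdjoint_obsPM (IsSelfAdjoint.one _)
  have sB (M : BinaryMeasurement n) : IsSelfAdjoint ((1 : Matrix m m ℂ) ⊗ₖ M.obsPM) :=
    isSelfAdjoint_kronecker (IsSelfAdjoint.one _) M.isSelfAdjoint_obsPM
  have qA (M : BinaryMeasurement m) :
      (M.obsPM ⊗ₖ (1 : Matrix n n ℂ)) * (M.obsPM ⊗ₖ (1 : Matrix n n ℂ)) = 1 := by
    rw [← Matrix.mul_kronecker_mul, M.obsPM_mul_self, mul_one, Matrix.one_kronecker_one]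
  have qB (M : BinaryMeasurement n) :
      ((1 : Matrix m m ℂ) ⊗ₖ M.obsPM) * ((1 : Matrix m m ℂ) ⊗ₖ M.obsPM) = 1 := by
    rw [← Matrix.mul_kronecker_mul, M.obsPM_mul_self, mul_one, Matrix.one_kronecker_one]
  have c (M : BinaryMeasurement m) (N : BinaryMeasurement n) :
      Commute (M.obsPM ⊗ₖ (1 : Matrix n n ℂ)) ((1 : Matrix m m ℂ) ⊗ₖ N.obsPM) := by
    rw [Commute, SemiconjBy, ← Matrix.mul_kronecker_mul, ← Matrix.mul_kronecker_mul]
    simp only [one_mul, mul_one]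
  exact ⟨sA _, sA _, sA _, sB _, sB _, sB _, qA _, qA _, qA _, qB _, qB _, qB _,
    c _ _, c _ _, c _ _, c _ _, c _ _, c _ _, c _ _, c _ _⟩

end Bipartite

theorem le_of_mem_quantumValuesGamma {x : ℝ} (hx : x ∈ quantumValuesGamma) : x ≤ 5 := by
  obtain ⟨ρ, A₁, A₂, A₃, B₁, B₄, B₆, hρ, rfl⟩ := hx
  rw [bellOpGamma_eq_bellGamma]
  refine (isStateFunctional_expectation hρ).bellGamma_le
    (isBipartite_kronecker A₁ A₂ A₃ B₁ B₄ B₆) ?_ ?_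
  · rcases A₁.obsPM_alternatives A₂ with h | h | h | h | ⟨c, h⟩
    · left; rw [h, Matrix.one_kronecker_one]
    · right; left; rw [h, neg_kronecker_one, Matrix.one_kronecker_one]
    · right; right; left; rw [h, Matrix.one_kronecker_one]
    · right; right; right; left; rw [h, neg_kronecker_one, Matrix.one_kronecker_one]
    · refine Or.inr (Or.inr (Or.inr (Or.inr ⟨c, ?_⟩)))
      rw [← Matrix.mul_kronecker_mul, ← Matrix.mul_kronecker_mul, ← Matrix.add_kronecker, mul_one,
        h, Matrix.smul_kronecker, Matrix.one_kronecker_one]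
  · rcases B₁.obsPM_alternatives B₄ with h | h | h | h | ⟨c, h⟩
    · left; rw [h, Matrix.one_kronecker_one]
    · right; left; rw [h, one_kronecker_neg, Matrix.one_kronecker_one]
    · right; right; left; rw [h, Matrix.one_kronecker_one]
    · right; right; right; left; rw [h, one_kronecker_neg, Matrix.one_kronecker_one]
    · refine Or.inr (Or.inr (Or.inr (Or.inr ⟨c, ?_⟩)))
      rw [← Matrix.mul_kronecker_mul, ← Matrix.mul_kronecker_mul, ← Matrix.kronecker_add, mul_one,
        h, Matrix.kronecker_smul, Matrix.one_kronecker_one]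

theorem trace_bellOpGamma_obsPM {ρ : Matrix (Fin 2 × Fin 2) (Fin 2 × Fin 2) ℂ}
    (hρ : IsDensityMatrix ρ) (A₁ A₂ A₃ B₁ B₄ B₆ : BinaryMeasurement (Fin 2)) :
    (bellOpGamma A₁.obsPM A₂.obsPM A₃.flip.obsPM B₁.flip.obsPM B₄.flip.obsPM B₆.obsPM
        * ρ).trace.re =
      4 * (bellOpV A₁.obs01 A₂.obs01 A₃.obs01 B₁.obs01 B₄.obs01 B₆.obs01 * ρ).trace.re + 4 := by
  simp only [BinaryMeasurement.obsPM_flip]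
  rw [bellOpGamma_obsPM, Matrix.one_kronecker_one, add_mul, smul_mul_assoc, smul_mul_assoc,
    one_mul, Matrix.trace_add, Matrix.trace_smul, Matrix.trace_smul, hρ.2]
  simp

theorem mem_quantumValuesV_iff {x : ℝ} :
    x ∈ quantumValuesV ↔ 4 * x + 4 ∈ quantumValuesGamma := by
  constructor
  · rintro ⟨ρ, A₁, A₂, A₃, B₁, B₄, B₆, hρ, rfl⟩
    exact ⟨ρ, A₁, A₂, A₃.flip, B₁.flip, B₄.flip, B₆, hρ,
      (trace_bellOpGamma_obsPM hρ A₁ A₂ A₃ B₁ B₄ B₆).symm⟩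
  · rintro ⟨ρ, A₁, A₂, A₃, B₁, B₄, B₆, hρ, h⟩
    refine ⟨ρ, A₁, A₂, A₃.flip, B₁.flip, B₄.flip, B₆, hρ, ?_⟩
    have := trace_bellOpGamma_obsPM hρ A₁ A₂ A₃.flip B₁.flip B₄.flip B₆
    simp only [BinaryMeasurement.flip_flip] at this
    linarith

/-! ### Attaining the bound with the singlet -/

/-- The real reflection matrix with entries `z, x, x, -z`. -/
def reflectionMatrix (z x : ℝ) : Matrix (Fin 2) (Fin 2) ℂ := !![(z : ℂ), x; x, -z]

theorem isSelfAdjoint_reflectionMatrix (z x : ℝ) : IsSelfAdjoint (reflectionMatrix z x) := by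
  ext i j
  fin_cases i <;> fin_cases j <;> simp [reflectionMatrix, Matrix.star_apply]

theorem reflectionMatrix_mul_self {z x : ℝ} (h : z ^ 2 + x ^ 2 = 1) :
    reflectionMatrix z x * reflectionMatrix z x = 1 := by
  have h' : (z : ℂ) ^ 2 + (x : ℂ) ^ 2 = 1 := by exact_mod_cast h
  ext i j
  fin_cases i <;> fin_cases j <;> simp [reflectionMatrix]
  · linear_combination h'
  · ring
  · ring
  · linear_combination h'

/-- The measurement of a spin component in the `x`-`z` plane. -/
noncomputable def spinMeasurement (z x : ℝ) (h : z ^ 2 + x ^ 2 = 1) :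
    BinaryMeasurement (Fin 2) :=
  BinaryMeasurement.ofInvolution (reflectionMatrix z x) (isSelfAdjoint_reflectionMatrix z x)
    (reflectionMatrix_mul_self h)

theorem obsPM_spinMeasurement {z x : ℝ} (h : z ^ 2 + x ^ 2 = 1) :
    (spinMeasurement z x h).obsPM = reflectionMatrix z x :=
  BinaryMeasurement.obsPM_ofInvolution _ _ _

/-- The unnormalized singlet vector `|01⟩ - |10⟩`. -/
def singletVector : Fin 2 × Fin 2 → ℂ := fun i => !![0, 1; -1, 0] i.1 i.2

/-- The singlet state. -/
noncomputable def singletState : Matrix (Fin 2 × Fin 2) (Fin 2 × Fin 2) ℂ :=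
  (2⁻¹ : ℝ) • Matrix.vecMulVec singletVector (star singletVector)

theorem isDensityMatrix_singletState : IsDensityMatrix singletState := by
  refine ⟨(Matrix.posSemidef_vecMulVec_self_star singletVector).smul (by norm_num), ?_⟩
  simp [singletState, Matrix.trace, Fintype.sum_prod_type, Matrix.vecMulVec_apply, singletVector]
  norm_num

theorem five_mem_quantumValuesGamma : (5 : ℝ) ∈ quantumValuesGamma := by
  have h3 : (√3 / 2) ^ 2 = (3 / 4 : ℝ) := by
    rw [div_pow, Real.sq_sqrt (by norm_num)]; norm_num
  have hp : (1 / 2 : ℝ) ^ 2 + (√3 / 2) ^ 2 = 1 := by rw [h3]; norm_num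
  have hm : (-(1 / 2) : ℝ) ^ 2 + (√3 / 2) ^ 2 = 1 := by rw [h3]; norm_num
  -- Singlet correlations are minus the inner product of the spin directions and the marginals
  -- vanish, so `-ST`, `-DB₆`, `-A₃F` contribute `3 + 1 + 1`. Here `p = q = √3 / 2`, which gives
  -- equality in the uncertainty bounds with `u = 0`, `k = 1`.
  refine ⟨singletState, spinMeasurement _ _ hp, spinMeasurement _ _ hm,
    spinMeasurement 1 0 (by norm_num), spinMeasurement _ _ hp, spinMeasurement _ _ hm,
    spinMeasurement 1 0 (by norm_num), isDensityMatrix_singletState, ?_⟩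
  simp only [obsPM_spinMeasurement]
  generalize √3 / 2 = r at h3
  simp [bellOpGamma, singletState, Matrix.trace, Matrix.mul_apply, Fintype.sum_prod_type,
    Matrix.vecMulVec_apply, singletVector, reflectionMatrix]
  linarith

theorem mainTheorem3 :
    -- the operator identity, with the outcomes of `A₃`, `B₁`, `B₄` relabelled on the left
    (∀ {m n : Type*} [Fintype m] [DecidableEq m] [Fintype n] [DecidableEq n]
      (A₁ A₂ A₃ : BinaryMeasurement m) (B₁ B₄ B₆ : BinaryMeasurement n),
      bellOpGamma A₁.obsPM A₂.obsPM (-A₃.obsPM) (-B₁.obsPM) (-B₄.obsPM) B₆.obsPM =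
        (4 : ℂ) • bellOpV A₁.obs01 A₂.obs01 A₃.obs01 B₁.obs01 B₄.obs01 B₆.obs01
          + (4 : ℂ) • ((1 : Matrix m m ℂ) ⊗ₖ (1 : Matrix n n ℂ))) ∧
    -- the suprema are genuine least upper bounds of non-empty bounded sets
    IsLUB quantumValuesV tsirelsonV ∧ IsLUB quantumValuesGamma tsirelsonGamma ∧
    tsirelsonGamma = 4 * tsirelsonV + 4 ∧
    (0.25 ≤ tsirelsonV ∧ tsirelsonV ≤ 0.25085) ∧
    (1 ≤ tsirelsonGamma - 4 ∧ tsirelsonGamma - 4 ≤ 1.0034) := by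
  have bV : ∀ x ∈ quantumValuesV, x ≤ 1 / 4 := fun x hx => by
    linarith [le_of_mem_quantumValuesGamma (mem_quantumValuesV_iff.mp hx)]
  have mV : (1 / 4 : ℝ) ∈ quantumValuesV := by
    rw [mem_quantumValuesV_iff]
    convert five_mem_quantumValuesGamma using 1
    norm_num
  have gV : IsGreatest quantumValuesV (1 / 4) := ⟨mV, bV⟩
  have gG : IsGreatest quantumValuesGamma 5 :=
    ⟨five_mem_quantumValuesGamma, fun _ => le_of_mem_quantumValuesGamma⟩
  have eV : tsirelsonV = 1 / 4 := gV.csSup_eq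
  have eG : tsirelsonGamma = 5 := gG.csSup_eq
  rw [eV, eG]
  refine ⟨fun A₁ A₂ A₃ B₁ B₄ B₆ => bellOpGamma_obsPM A₁ A₂ A₃ B₁ B₄ B₆, gV.isLUB, gG.isLUB,
    ?_, ?_, ?_⟩ <;> norm_num
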